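/- Let $\mathcal S,\mathcal Z$ be finite sets, $P$ a primitive row-stochastic $|\mathcal S|\times|\mathcal S|$ matrix ($P^k$ has strictly positive entries for some $k\ge 1$) and $T$ a row-stochastic $|\mathcal S|\times|\mathcal Z|$ matrix with strictly positive entries. Let $(S_n,Z_n)_{n\ge 0}$ be a hidden Markov process with transition matrix $P$ and emission matrix $T$, not necessarily stationary: the law of $S_0$ is arbitrary and, for all $n\ge 0$ and whenever the conditioning event has positive probability, $p(s_{n+1}\mid s_0,\dots,s_n)=P[s_n,s_{n+1}]$, $p(s_{n+1}\mid s_n,z_0,\dots,z_n)=P[s_n,s_{n+1}]$ and $p(z_0,\dots,z_n\mid s_0,\dots,s_n)=\prod_{i=0}^n T[s_i,z_i]$. Let $\nabla_{\mathcal S},\nabla_{\mathcal Z}$ be the probability simplices (row vectors) over $\mathcal S,\mathcal Z$. For $\pi\in\nabla_{\mathcal S}$ and $z\in\mathcal Z$ put $\zeta(\pi)=\pi T\in\nabla_{\mathcal Z}$ and $\eta(z,\pi)=\dfrac{\pi D(z)P}{\pi D(z)\mathbf 1}\in\nabla_{\mathcal S}$, where $D(z)$ is the diagonal matrix with entries $D(z)_{k,k}=T[k,z]$.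 The iterated function system on $\nabla_{\mathcal S}$ with maps $F_z=\eta(z,\cdot)$ and probabilities $q_z(x)=\zeta(x)[z]$ induces the Markov operator on Borel probability measures $\Phi(\nu)(B)=\sum_{z}\int 1_B(F_z(x))\,q_z(x)\,\nu(dx)$. A Borel probability measure $\mu$ on $\nabla_{\mathcal S}$ is called invariant if $\Phi\mu=\mu$, and attractive if $\Phi^n\nu\to\mu$ weakly for every Borel probability measure $\nu$ on $\nabla_{\mathcal S}$. Let $h_1,h_2$ be the entropy functions $h(p)=-\sum_i p[i]\log p[i]$ on $\nabla_{\mathcal Z},\nabla_{\mathcal S}$ (natural logarithm, also used for all entropies below). Then an attractive and invariant measure of $\Phi$ exists, and for every attractive and invariant measure $\mu$ of $\Phi$ the entropy rate and the estimation entropy exist and are given by $$\hat H_Z=\lim_{n\to\infty}\frac1n H(Z_0,\dots,Z_n)=\int_{\nabla_{\mathcal S}} (h_1\circ\zeta)\,d\mu,\qquad \hat H_{S/Z}=\lim_{n\to\infty}H(S_n\mid Z_0,\dots,Z_{n-1})=\int_{\nabla_{\mathcal S}} h_2\,d\mu .$$ -/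

import Mathlib

open MeasureTheory Filter
open scoped ENNReal NNReal Topology Matrix

noncomputable section

namespace HMP

/-! ### Iterated function systems and their Markov operators -/

/-- An iterated function system on `X` with index set `ι`: measurable maps `F i : X → X` and
measurable place-dependent probabilities `q i : X → [0, ∞)` with `∑ i, q i = 1`. -/
structure IFS (ι X : Type*) [Fintype ι] [MeasurableSpace X] where
  F : ι → X → X
  q : ι → X → ℝ≥0
  measurable_F : ∀ i, Measurable (F i)
  measurable_q : ∀ i, Measurable (q i)
  sum_q : ∀ x, ∑ i, q i x = 1

namespace IFS

variable {ι X : Type*} [Fintype ι] [MeasurableSpace X]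

/-- `Φ(ν)` as a measure: the sum over `i` of the push-forwards under `F i` of `q i · ν`. -/
def opMeasure (𝓕 : IFS ι X) (ν : Measure X) : Measure X :=
  ∑ i, (ν.withDensity fun x => (𝓕.q i x : ℝ≥0∞)).map (𝓕.F i)

/-- The defining formula `Φ(ν)(B) = ∑ i, ∫ 1_B(F i x) q i x ν(dx)`. -/
theorem opMeasure_apply (𝓕 : IFS ι X) (ν : Measure X) {B : Set X} (hB : MeasurableSet B) :
    𝓕.opMeasure ν B
      = ∑ i, ∫⁻ x, B.indicator 1 (𝓕.F i x) * (𝓕.q i x : ℝ≥0∞) ∂ν := by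
  simp only [opMeasure, Measure.coe_finsetSum, Finset.sum_apply]
  refine Finset.sum_congr rfl fun i _ => ?_
  rw [Measure.map_apply (𝓕.measurable_F i) hB,
    withDensity_apply _ (𝓕.measurable_F i hB), ← lintegral_indicator (𝓕.measurable_F i hB)]
  refine lintegral_congr fun x => ?_
  by_cases hx : 𝓕.F i x ∈ B
  · simp [Set.indicator, hx]
  · simp [Set.indicator, hx]

theorem opMeasure_univ (𝓕 : IFS ι X) (ν : Measure X) [IsProbabilityMeasure ν] :
    𝓕.opMeasure ν Set.univ = 1 := by
  have h : ∀ x, ∑ i, (𝓕.q i x : ℝ≥0∞) = 1 := by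
    intro x
    have := congrArg (fun t : ℝ≥0 => (t : ℝ≥0∞)) (𝓕.sum_q x)
    simpa using this
  rw [opMeasure_apply _ _ MeasurableSet.univ]
  simp only [Set.indicator_univ, Pi.one_apply, one_mul]
  rw [← lintegral_finsetSum _ fun i _ => (𝓕.measurable_q i).coe_nnreal_ennreal]
  simp [h]

/-- The Markov operator `Φ` induced by an iterated function system on probability measures. -/
def markovOperator (𝓕 : IFS ι X) (ν : ProbabilityMeasure X) : ProbabilityMeasure X :=
  ⟨𝓕.opMeasure (ν : Measure X), ⟨𝓕.opMeasure_univ (ν : Measure X)⟩⟩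

/-- `μ` is invariant: `Φ μ = μ`. -/
def IsInvariant (𝓕 : IFS ι X) (μ : ProbabilityMeasure X) : Prop :=
  𝓕.markovOperator μ = μ

/-- `μ` is attractive: `Φⁿ ν → μ` weakly, for every probability measure `ν`. -/
def IsAttractive [TopologicalSpace X] [OpensMeasurableSpace X] (𝓕 : IFS ι X)
    (μ : ProbabilityMeasure X) : Prop :=
  ∀ ν : ProbabilityMeasure X, Tendsto (fun n : ℕ => 𝓕.markovOperator^[n] ν) atTop (𝓝 μ)

end IFS

/-! ### The iterated function system of a hidden Markov process -/

section System

/-- The normalising constant of `η(z, π)` is positive when `T` has positive entries. -/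
theorem denom_pos {𝓢 𝓩 : Type*} [Fintype 𝓢] [DecidableEq 𝓢] {T : Matrix 𝓢 𝓩 ℝ} (hpos : ∀ s z, 0 < T s z) (z : 𝓩) {x : 𝓢 → ℝ}
    (hx : x ∈ stdSimplex ℝ 𝓢) : 0 < (x ᵥ* Matrix.diagonal fun k => T k z) ⬝ᵥ 1 := by
  simp only [dotProduct, Matrix.vecMul_diagonal, Pi.one_apply, mul_one]
  obtain ⟨s, hs⟩ : ∃ s, 0 < x s := by
    by_contra! h
    have : ∑ s, x s ≤ 0 := Finset.sum_nonpos fun s _ => h s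
    rw [hx.2] at this
    linarith
  exact Finset.sum_pos' (fun k _ => mul_nonneg (hx.1 k) (hpos k z).le)
    ⟨s, Finset.mem_univ s, mul_pos hs (hpos s z)⟩

theorem continuous_vecMul {𝓢 𝓩 : Type*} [Fintype 𝓢] {A : Matrix 𝓢 𝓩 ℝ} : Continuous fun x : 𝓢 → ℝ => x ᵥ* A :=
  continuous_id.matrix_vecMul continuous_const

variable {𝓢 𝓩 : Type*} [Fintype 𝓢] [Fintype 𝓩]

/-- A (rectangular) stochastic matrix: nonnegative entries, all rows sum to `1`. -/
def IsStochastic (A : Matrix 𝓢 𝓩 ℝ) : Prop :=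
  (∀ s z, 0 ≤ A s z) ∧ ∀ s, ∑ z, A s z = 1

/-- A row-stochastic matrix maps the simplex into the simplex. -/
theorem vecMul_mem_stdSimplex {A : Matrix 𝓢 𝓩 ℝ} (hA : IsStochastic A) {x : 𝓢 → ℝ}
    (hx : x ∈ stdSimplex ℝ 𝓢) : x ᵥ* A ∈ stdSimplex ℝ 𝓩 := by
  refine ⟨fun z => Finset.sum_nonneg fun s _ => mul_nonneg (hx.1 s) (hA.1 s z), ?_⟩
  simp only [Matrix.vecMul, dotProduct]
  rw [Finset.sum_comm]
  simp [← Finset.mul_sum, hA.2, hx.2]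

/-- `ζ(π) = π T`, as a map of probability simplices. -/
def zeta (T : Matrix 𝓢 𝓩 ℝ) (hT : IsStochastic T) (x : stdSimplex ℝ 𝓢) : stdSimplex ℝ 𝓩 :=
  ⟨(x : 𝓢 → ℝ) ᵥ* T, vecMul_mem_stdSimplex hT x.2⟩

variable [DecidableEq 𝓢]

/-- The vector `η(z, π) = π D(z) P / (π D(z) 1)`, where `D(z)` is diagonal with entries
`T[k, z]`. -/
def etaVec (P : Matrix 𝓢 𝓢 ℝ) (T : Matrix 𝓢 𝓩 ℝ) (z : 𝓩) (x : 𝓢 → ℝ) : 𝓢 → ℝ :=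
  ((x ᵥ* Matrix.diagonal fun k => T k z) ⬝ᵥ 1)⁻¹ •
    ((x ᵥ* Matrix.diagonal fun k => T k z) ᵥ* P)

theorem etaVec_mem_stdSimplex {𝓢 𝓩 : Type*} [Fintype 𝓢] [DecidableEq 𝓢] {P : Matrix 𝓢 𝓢 ℝ} {T : Matrix 𝓢 𝓩 ℝ} (hP : IsStochastic P)
    (hpos : ∀ s z, 0 < T s z) (z : 𝓩) {x : 𝓢 → ℝ} (hx : x ∈ stdSimplex ℝ 𝓢) :
    etaVec P T z x ∈ stdSimplex ℝ 𝓢 := by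
  have hd := denom_pos hpos z hx
  have hmem : ((x ᵥ* Matrix.diagonal fun k => T k z) ⬝ᵥ 1)⁻¹ •
      (x ᵥ* Matrix.diagonal fun k => T k z) ∈ stdSimplex ℝ 𝓢 := by
    refine ⟨fun k => ?_, ?_⟩
    · simp only [Pi.smul_apply, smul_eq_mul, Matrix.vecMul_diagonal]
      exact mul_nonneg (inv_nonneg.2 hd.le) (mul_nonneg (hx.1 k) (hpos k z).le)
    · have : ∑ k, (x ᵥ* Matrix.diagonal fun k => T k z) k
          = (x ᵥ* Matrix.diagonal fun k => T k z) ⬝ᵥ 1 := by simp [dotProduct]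
      simp only [Pi.smul_apply, smul_eq_mul]
      rw [← Finset.mul_sum, this, inv_mul_cancel₀ hd.ne']
  have := vecMul_mem_stdSimplex hP hmem
  rwa [Matrix.smul_vecMul] at this

/-- `η(z, ·)` as a self-map of the probability simplex. -/
def eta (P : Matrix 𝓢 𝓢 ℝ) (T : Matrix 𝓢 𝓩 ℝ) (hP : IsStochastic P)
    (hpos : ∀ s z, 0 < T s z) (z : 𝓩) (x : stdSimplex ℝ 𝓢) : stdSimplex ℝ 𝓢 :=
  ⟨etaVec P T z x, etaVec_mem_stdSimplex hP hpos z x.2⟩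

theorem continuous_eta (P : Matrix 𝓢 𝓢 ℝ) (T : Matrix 𝓢 𝓩 ℝ) (hP : IsStochastic P)
    (hpos : ∀ s z, 0 < T s z) (z : 𝓩) : Continuous (eta P T hP hpos z) := by
  refine Continuous.subtype_mk ?_ _
  have h1 : Continuous fun x : stdSimplex ℝ 𝓢 =>
      ((x : 𝓢 → ℝ) ᵥ* Matrix.diagonal fun k => T k z) :=
    continuous_vecMul.comp continuous_subtype_val
  exact ((h1.dotProduct continuous_const).inv₀ fun x => (denom_pos hpos z x.2).ne').smul
    (continuous_vecMul.comp h1)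

/-- The iterated function system of a hidden Markov process on the simplex of its states:
`F_z(x) = η(z, x)` and `q_z(x) = ζ(x)[z]`. -/
def hmpIFS (P : Matrix 𝓢 𝓢 ℝ) (T : Matrix 𝓢 𝓩 ℝ) (hP : IsStochastic P) (hT : IsStochastic T)
    (hpos : ∀ s z, 0 < T s z) : IFS 𝓩 (stdSimplex ℝ 𝓢) where
  F := eta P T hP hpos
  q z x := NNReal.mk (zeta T hT x z) (stdSimplex.zero_le (zeta T hT x) z)
  measurable_F z := (continuous_eta P T hP hpos z).measurable
  measurable_q z := (Continuous.subtype_mk ((continuous_apply z).comp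
    (continuous_vecMul.comp continuous_subtype_val)) _).measurable
  sum_q x := by
    apply NNReal.coe_injective
    rw [NNReal.coe_sum]
    exact stdSimplex.sum_eq_one (zeta T hT x)

end System

/-! ### Entropies (in nats) -/

section Entropy

variable {Ω α β : Type*} [MeasurableSpace Ω] [Fintype α] [Fintype β]

/-- The entropy function `h(p) = ∑ i, -p[i] log p[i]` (with `0 log 0 = 0`). -/
def h (p : α → ℝ) : ℝ := ∑ i, Real.negMulLog (p i)

/-- The entropy `H(X)` of a random variable with finitely many values. -/
def entropy (ℙ : Measure Ω) (X : Ω → α) : ℝ := h fun x => ℙ.real {ω | X ω = x}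

/-- The conditional entropy `H(X | Y) = ∑ y, Pr(Y = y) H(X | Y = y)`. -/
def condEntropy (ℙ : Measure Ω) (X : Ω → α) (Y : Ω → β) : ℝ :=
  ∑ y, ℙ.real {ω | Y ω = y} *
    h fun x => (ProbabilityTheory.cond ℙ {ω | Y ω = y}).real {ω | X ω = x}

/-- The random vector `(X 0, …, X (n - 1))`. -/
def block {γ : Type*} (X : ℕ → Ω → γ) (n : ℕ) (ω : Ω) : Fin n → γ := fun i => X i ω

/-- The entropy rate `lim (1/n) H(Z_0, …, Z_n)` exists and equals `c`. -/
def HasEntropyRate (ℙ : Measure Ω) (Z : ℕ → Ω → β) (c : ℝ) : Prop :=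
  Tendsto (fun n : ℕ => (1 / (n : ℝ)) * entropy ℙ (block Z (n + 1))) atTop (𝓝 c)

/-- The estimation entropy `lim H(S_n | Z_0, …, Z_{n-1})` exists and equals `c`. -/
def HasEstimationEntropy (ℙ : Measure Ω) (S : ℕ → Ω → α) (Z : ℕ → Ω → β) (c : ℝ) : Prop :=
  Tendsto (fun n : ℕ => condEntropy ℙ (S n) (block Z n)) atTop (𝓝 c)

end Entropy

/-! ### Hidden Markov processes -/

/-- `(S_n, Z_n)` is a hidden Markov process with transition matrix `P` and emission matrix `T`:
the law of `S 0` is arbitrary, and the three conditional-probability identities hold whenever the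
conditioning event has positive probability. -/
structure IsHiddenMarkovProcess {Ω 𝓢 𝓩 : Type*} [MeasurableSpace Ω] [MeasurableSpace 𝓢]
    [MeasurableSpace 𝓩] (ℙ : Measure Ω) (P : Matrix 𝓢 𝓢 ℝ) (T : Matrix 𝓢 𝓩 ℝ)
    (S : ℕ → Ω → 𝓢) (Z : ℕ → Ω → 𝓩) : Prop where
  measurable_state : ∀ n, Measurable (S n)
  measurable_obs : ∀ n, Measurable (Z n)
  /-- Markovity: `p(s_{n+1} | s_0, …, s_n) = P[s_n, s_{n+1}]`. -/
  markov : ∀ (n : ℕ) (s : ℕ → 𝓢), ℙ {ω | ∀ i ≤ n, S i ω = s i} ≠ 0 →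
    (ProbabilityTheory.cond ℙ {ω | ∀ i ≤ n, S i ω = s i}).real {ω | S (n + 1) ω = s (n + 1)}
      = P (s n) (s (n + 1))
  /-- Sufficiency of the state: `p(s_{n+1} | s_n, z_0, …, z_n) = P[s_n, s_{n+1}]`. -/
  sufficient : ∀ (n : ℕ) (s s' : 𝓢) (z : ℕ → 𝓩),
    ℙ {ω | S n ω = s ∧ ∀ i ≤ n, Z i ω = z i} ≠ 0 →
    (ProbabilityTheory.cond ℙ {ω | S n ω = s ∧ ∀ i ≤ n, Z i ω = z i}).real
      {ω | S (n + 1) ω = s'} = P s s'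
  /-- Memoryless observation: `p(z_0, …, z_n | s_0, …, s_n) = ∏ T[s_i, z_i]`. -/
  memoryless : ∀ (n : ℕ) (s : ℕ → 𝓢) (z : ℕ → 𝓩), ℙ {ω | ∀ i ≤ n, S i ω = s i} ≠ 0 →
    (ProbabilityTheory.cond ℙ {ω | ∀ i ≤ n, S i ω = s i}).real {ω | ∀ i ≤ n, Z i ω = z i}
      = ∏ i ∈ Finset.range (n + 1), T (s i) (z i)

end HMP

end

/-! Write `x` for the initial law. Since every entry of `T` is positive, each observed word has
positive probability, and the composition of the maps `η(z, ·)` along the word is the conditional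
law of the present state given that word. Hence the dual operator `f ↦ ∑ z, q z · (f ∘ F z)`,
iterated `n` times and evaluated at `x`, is the expectation of `f` at this random conditional law.
With `f = h` it is `H(S_n | Z_0, …, Z_{n-1})` (`condEntropy_eq`); with `f = h ∘ ζ` it is the
increment of the block entropy (`entropy_block_succ`). Attractiveness, tested on the point mass at
`x`, makes both converge to integrals against `μ`; a Cesàro mean then yields the entropy rate.

Existence of `μ` follows from compactness once dual iterates of every continuous function become
nearly constant (`IFS.IsFeller.exists_isAttractive`). Two contractions give this. Products of
matrices `D(z) P` contract ratios, so the filter forgets its starting point uniformly in the word,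
and an iterate of `f` is then nearly linear in the starting law. On linear functions the dual
operator is multiplication by `P`, whose powers flatten every vector. -/

namespace HMP

/-! ### Feller iterated function systems and duality -/

namespace IFS

variable {ι X : Type*} [Fintype ι] [MeasurableSpace X]

/-- The operator on functions dual to the Markov operator of an iterated function system:
`f ↦ ∑ i, q i · (f ∘ F i)`. -/
noncomputable def dual (𝓕 : IFS ι X) (f : X → ℝ) (x : X) : ℝ := ∑ i, (𝓕.q i x : ℝ) * f (𝓕.F i x)

theorem sum_coe_q (𝓕 : IFS ι X) (x : X) : ∑ i, (𝓕.q i x : ℝ) = 1 := by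
  exact_mod_cast congrArg NNReal.toReal (𝓕.sum_q x)

theorem abs_dual_sub_le (𝓕 : IFS ι X) {f g : X → ℝ} {ε : ℝ} (hfg : ∀ x, |f x - g x| ≤ ε) (x : X) :
    |𝓕.dual f x - 𝓕.dual g x| ≤ ε := by
  simp only [dual, ← Finset.sum_sub_distrib, ← mul_sub]
  calc |∑ i, (𝓕.q i x : ℝ) * (f (𝓕.F i x) - g (𝓕.F i x))|
      ≤ ∑ i, (𝓕.q i x : ℝ) * ε := by
        refine (Finset.abs_sum_le_sum_abs _ _).trans (Finset.sum_le_sum fun i _ => ?_)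
        rw [abs_mul, abs_of_nonneg (𝓕.q i x).coe_nonneg]
        exact mul_le_mul_of_nonneg_left (hfg _) (𝓕.q i x).coe_nonneg
    _ = ε := by rw [← Finset.sum_mul, sum_coe_q, one_mul]

theorem abs_dual_iterate_sub_le (𝓕 : IFS ι X) {f g : X → ℝ} {ε : ℝ} (hfg : ∀ x, |f x - g x| ≤ ε)
    (n : ℕ) (x : X) : |𝓕.dual^[n] f x - 𝓕.dual^[n] g x| ≤ ε := by
  induction n generalizing x with
  | zero => exact hfg x
  | succ n ih =>
    simp only [Function.iterate_succ_apply']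
    exact 𝓕.abs_dual_sub_le ih x

theorem dual_const (𝓕 : IFS ι X) (c : ℝ) : 𝓕.dual (fun _ => c) = fun _ => c := by
  funext x
  simp only [dual, ← Finset.sum_mul, sum_coe_q, one_mul]

theorem dual_iterate_const (𝓕 : IFS ι X) (c : ℝ) (n : ℕ) :
    𝓕.dual^[n] (fun _ => c) = fun _ => c :=
  Function.iterate_fixed (𝓕.dual_const c) n

variable [TopologicalSpace X]

/-- The Feller condition: all maps and all probabilities are continuous. -/
structure IsFeller (𝓕 : IFS ι X) : Prop where
  continuous_F : ∀ i, Continuous (𝓕.F i)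
  continuous_q : ∀ i, Continuous (𝓕.q i)

theorem IsFeller.continuous_dual {𝓕 : IFS ι X} (h𝓕 : 𝓕.IsFeller) {f : X → ℝ}
    (hf : Continuous f) : Continuous (𝓕.dual f) :=
  continuous_finsetSum _ fun i _ =>
    (NNReal.continuous_coe.comp (h𝓕.continuous_q i)).mul (hf.comp (h𝓕.continuous_F i))

theorem IsFeller.continuous_dual_iterate {𝓕 : IFS ι X} (h𝓕 : 𝓕.IsFeller) {f : X → ℝ}
    (hf : Continuous f) (n : ℕ) : Continuous (𝓕.dual^[n] f) := by
  induction n with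
  | zero => exact hf
  | succ n ih =>
    rw [Function.iterate_succ_apply']
    exact h𝓕.continuous_dual ih

variable [CompactSpace X] [BorelSpace X]

theorem _root_.Continuous.integrable_of_compactSpace (ν : Measure X) [IsFiniteMeasure ν]
    {f : X → ℝ} (hf : Continuous f) : Integrable f ν :=
  (BoundedContinuousFunction.mkOfCompact ⟨f, hf⟩).integrable ν

theorem IsFeller.integral_markovOperator {𝓕 : IFS ι X} (h𝓕 : 𝓕.IsFeller) {f : X → ℝ}
    (hf : Continuous f) (ν : ProbabilityMeasure X) :
    ∫ x, f x ∂(𝓕.markovOperator ν : Measure X) = ∫ x, 𝓕.dual f x ∂(ν : Measure X) := by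
  have hi : ∀ i, Continuous fun x => (𝓕.q i x : ℝ) * f (𝓕.F i x) := fun i =>
    (NNReal.continuous_coe.comp (h𝓕.continuous_q i)).mul (hf.comp (h𝓕.continuous_F i))
  have hint : ∀ i, Integrable f
      (((ν : Measure X).withDensity fun x => (𝓕.q i x : ℝ≥0∞)).map (𝓕.F i)) := by
    intro i
    rw [integrable_map_measure hf.aestronglyMeasurable (𝓕.measurable_F i).aemeasurable,
      integrable_withDensity_iff_integrable_smul (𝓕.measurable_q i)]
    exact (hi i).integrable_of_compactSpace _
  change ∫ x, f x ∂(𝓕.opMeasure (ν : Measure X)) = _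
  rw [opMeasure, integral_finsetSum_measure fun i _ => hint i]
  simp only [dual]
  rw [integral_finsetSum _ fun i _ => (hi i).integrable_of_compactSpace _]
  refine Finset.sum_congr rfl fun i _ => ?_
  rw [integral_map (𝓕.measurable_F i).aemeasurable hf.aestronglyMeasurable,
    integral_withDensity_eq_integral_smul (𝓕.measurable_q i)]
  rfl

theorem IsFeller.integral_markovOperator_iterate {𝓕 : IFS ι X} (h𝓕 : 𝓕.IsFeller) {f : X → ℝ}
    (hf : Continuous f) (ν : ProbabilityMeasure X) (n : ℕ) :
    ∫ x, f x ∂(𝓕.markovOperator^[n] ν : Measure X) = ∫ x, 𝓕.dual^[n] f x ∂(ν : Measure X) := by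
  induction n generalizing f with
  | zero => rfl
  | succ n ih =>
    rw [Function.iterate_succ_apply', h𝓕.integral_markovOperator hf, ih (h𝓕.continuous_dual hf),
      Function.iterate_succ_apply]

/-- The Dirac mass at `x`, as a probability measure. -/
noncomputable def _root_.MeasureTheory.ProbabilityMeasure.pointMass (x : X) : ProbabilityMeasure X :=
  ⟨Measure.dirac x, inferInstance⟩

theorem IsFeller.integral_iterate_pointMass {𝓕 : IFS ι X} (h𝓕 : 𝓕.IsFeller) {f : X → ℝ}
    (hf : Continuous f) (x : X) (n : ℕ) :
    ∫ y, f y ∂(𝓕.markovOperator^[n] (.pointMass x) : Measure X) = 𝓕.dual^[n] f x := by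
  rw [h𝓕.integral_markovOperator_iterate hf]
  exact integral_dirac' _ _ (h𝓕.continuous_dual_iterate hf n).stronglyMeasurable

/-- Attractiveness is tested on the point mass at `x`, against which integrating a dual iterate
means evaluating it at `x`. -/
theorem IsFeller.tendsto_dual_iterate {𝓕 : IFS ι X} (h𝓕 : 𝓕.IsFeller)
    {μ : ProbabilityMeasure X} (hμ : 𝓕.IsAttractive μ) {f : X → ℝ} (hf : Continuous f) (x : X) :
    Tendsto (fun n => 𝓕.dual^[n] f x) atTop (𝓝 (∫ y, f y ∂(μ : Measure X))) := by
  have := ProbabilityMeasure.tendsto_iff_forall_integral_tendsto.1 (hμ (.pointMass x))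
    (BoundedContinuousFunction.mkOfCompact ⟨f, hf⟩)
  simpa [h𝓕.integral_iterate_pointMass hf] using this

theorem IsFeller.continuous_markovOperator {𝓕 : IFS ι X} (h𝓕 : 𝓕.IsFeller) :
    Continuous 𝓕.markovOperator := by
  refine continuous_iff_continuousAt.2 fun ν =>
    ProbabilityMeasure.tendsto_iff_forall_integral_tendsto.2 fun f => ?_
  simp only [h𝓕.integral_markovOperator f.continuous]
  exact ProbabilityMeasure.tendsto_iff_forall_integral_tendsto.1 tendsto_id
    (BoundedContinuousFunction.mkOfCompact ⟨_, h𝓕.continuous_dual f.continuous⟩)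

/-- The Markov operator is weakly continuous, so it fixes the limit of any of its convergent orbits.
-/
theorem IsFeller.isInvariant_of_isAttractive [T2Space X] [HasOuterApproxClosed X] [Nonempty X]
    {𝓕 : IFS ι X} (h𝓕 : 𝓕.IsFeller) {μ : ProbabilityMeasure X} (hμ : 𝓕.IsAttractive μ) :
    𝓕.IsInvariant μ := by
  obtain ⟨x⟩ := ‹Nonempty X›
  have h := hμ (.pointMass x)
  have h1 := (h𝓕.continuous_markovOperator.tendsto μ).comp h
  refine tendsto_nhds_unique h1 ?_
  simpa only [Function.comp_def, ← Function.iterate_succ_apply'] using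
    h.comp (tendsto_add_atTop_nat 1)

/-- A Feller system on a compact space whose dual operator eventually flattens every continuous
function has an attractive measure. -/
theorem IsFeller.exists_isAttractive [T2Space X] [Nonempty X] {𝓕 : IFS ι X} (h𝓕 : 𝓕.IsFeller)
    (hosc : ∀ f : X → ℝ, Continuous f → ∀ ε > 0, ∃ n, ∀ x y,
      |𝓕.dual^[n] f x - 𝓕.dual^[n] f y| ≤ ε) :
    ∃ μ : ProbabilityMeasure X, 𝓕.IsAttractive μ := by
  obtain ⟨x₀⟩ := ‹Nonempty X›
  set ρ : ℕ → ProbabilityMeasure X := fun n => 𝓕.markovOperator^[n] (.pointMass x₀)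
  -- Compactness of the space of probability measures gives a limit along an ultrafilter; no
  -- convergent subsequence is needed.
  obtain ⟨μ, hμ⟩ : ∃ μ, Tendsto ρ (hyperfilter ℕ : Filter ℕ) (𝓝 μ) :=
    ⟨_, ((hyperfilter ℕ).map ρ).le_nhds_lim⟩
  refine ⟨μ, fun ν => ProbabilityMeasure.tendsto_iff_forall_integral_tendsto.2 fun f => ?_⟩
  rw [Metric.tendsto_atTop]
  intro ε hε
  obtain ⟨N, hN⟩ := hosc f f.continuous (ε / 4) (by positivity)
  -- The dual operator fixes constants and does not increase the sup norm, so near-constancy at time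
  -- `N` persists, with the same constant.
  have hflat : ∀ n ≥ N, ∀ x, |𝓕.dual^[n] f x - 𝓕.dual^[N] f x₀| ≤ ε / 4 := by
    intro n hn x
    obtain ⟨m, rfl⟩ := Nat.exists_eq_add_of_le' hn
    have := 𝓕.abs_dual_iterate_sub_le (f := 𝓕.dual^[N] f) (g := fun _ => 𝓕.dual^[N] f x₀)
      (fun y => hN y x₀) m x
    rwa [𝓕.dual_iterate_const, ← Function.iterate_add_apply] at this
  have hlim : |∫ x, f x ∂(μ : Measure X) - 𝓕.dual^[N] f x₀| ≤ ε / 4 := by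
    have h1 := ((ProbabilityMeasure.tendsto_iff_forall_integral_tendsto.1 hμ f).sub_const
      (𝓕.dual^[N] f x₀)).abs
    refine le_of_tendsto h1 (Nat.hyperfilter_le_atTop ((eventually_ge_atTop N).mono fun n hn => ?_))
    simp only [ρ, h𝓕.integral_iterate_pointMass f.continuous]
    exact hflat n hn x₀
  refine ⟨N, fun n hn => ?_⟩
  have hint := (h𝓕.continuous_dual_iterate f.continuous n).integrable_of_compactSpace
    (ν : Measure X)
  have hclose : |∫ x, 𝓕.dual^[n] f x ∂(ν : Measure X) - 𝓕.dual^[N] f x₀| ≤ ε / 4 := by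
    have h2 := norm_integral_le_of_norm_le_const (μ := (ν : Measure X)) (C := ε / 4)
      (f := fun x => 𝓕.dual^[n] f x - 𝓕.dual^[N] f x₀) (ae_of_all _ (hflat n hn))
    rw [integral_sub hint (integrable_const _)] at h2
    simpa using h2
  rw [h𝓕.integral_markovOperator_iterate f.continuous, Real.dist_eq]
  rw [abs_le] at hlim hclose
  rw [abs_lt]
  constructor <;> linarith [hlim.1, hlim.2, hclose.1, hclose.2]

end IFS

end HMP
namespace HMP

/-! ### Stochastic matrices and contraction of ratios -/

section Stochastic

variable {𝓢 𝓩 : Type*} [Fintype 𝓩]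

theorem IsStochastic.mulVec_one {A : Matrix 𝓢 𝓩 ℝ} (hA : IsStochastic A) :
    A *ᵥ 1 = 1 := by
  funext s
  simp [Matrix.mulVec, dotProduct, hA.2 s]

theorem IsStochastic.le_one {A : Matrix 𝓢 𝓩 ℝ} (hA : IsStochastic A)
    (s : 𝓢) (z : 𝓩) : A s z ≤ 1 :=
  hA.2 s ▸ Finset.single_le_sum (f := A s) (fun z _ => hA.1 s z) (Finset.mem_univ z)

theorem exists_emission_bound [Finite 𝓢] {T : Matrix 𝓢 𝓩 ℝ} (hpos : ∀ s z, 0 < T s z) : ∃ t > 0, ∀ s z, t ≤ T s z := by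
  rcases isEmpty_or_nonempty (𝓢 × 𝓩) with he | hne
  · exact ⟨1, one_pos, fun s z => he.elim (s, z)⟩
  obtain ⟨m, hm⟩ := Finite.exists_min fun p : 𝓢 × 𝓩 => T p.1 p.2
  exact ⟨_, hpos m.1 m.2, fun i j => hm (i, j)⟩

end Stochastic

section Contraction

variable {𝓢 : Type*} [Fintype 𝓢]

/-- A matrix with entries in `[δ, 1]` shrinks the range of the quotients `a j / h j` of two vectors
by the factor `1 - δ`. -/
theorem exists_ratio_bounds_mulVec {B : Matrix 𝓢 𝓢 ℝ} {δ : ℝ} (hδ : ∀ i j, δ ≤ B i j)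
    (hB : ∀ i j, B i j ≤ 1) (hδ0 : 0 ≤ δ) {a h : 𝓢 → ℝ} (hh : ∀ j, 0 < h j) {lo hi : ℝ}
    (hlo : ∀ j, lo * h j ≤ a j) (hhi : ∀ j, a j ≤ hi * h j) :
    ∃ lo' hi' : ℝ, hi' - lo' = (1 - δ) * (hi - lo) ∧
      ∀ i, lo' * (B *ᵥ h) i ≤ (B *ᵥ a) i ∧ (B *ᵥ a) i ≤ hi' * (B *ᵥ h) i := by
  rcases isEmpty_or_nonempty 𝓢 with he | hne
  · exact ⟨0, (1 - δ) * (hi - lo), by ring, fun i => he.elim i⟩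
  set H := ∑ j, h j with hH
  set A := ∑ j, a j with hA
  have hHpos : 0 < H := Finset.sum_pos (fun j _ => hh j) Finset.univ_nonempty
  have hle : ∀ i, (B *ᵥ h) i ≤ H := fun i => Finset.sum_le_sum fun j _ => by
    have := mul_le_mul_of_nonneg_right (hB i j) (hh j).le
    rwa [one_mul] at this
  have hA1 : lo * H ≤ A := by
    rw [hH, Finset.mul_sum]; exact Finset.sum_le_sum fun j _ => hlo j
  have hA2 : A ≤ hi * H := by
    rw [hH, Finset.mul_sum]; exact Finset.sum_le_sum fun j _ => hhi j
  have h1 : ∀ i, δ * (A - lo * H) ≤ (B *ᵥ a) i - lo * (B *ᵥ h) i := by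
    intro i
    simp only [hA, hH, Matrix.mulVec, dotProduct, Finset.mul_sum, ← Finset.sum_sub_distrib]
    refine Finset.sum_le_sum fun j _ => ?_
    have := mul_le_mul_of_nonneg_right (hδ i j) (sub_nonneg.2 (hlo j))
    linarith
  have h2 : ∀ i, δ * (hi * H - A) ≤ hi * (B *ᵥ h) i - (B *ᵥ a) i := by
    intro i
    simp only [hA, hH, Matrix.mulVec, dotProduct, Finset.mul_sum, ← Finset.sum_sub_distrib]
    refine Finset.sum_le_sum fun j _ => ?_
    have := mul_le_mul_of_nonneg_right (hδ i j) (sub_nonneg.2 (hhi j))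
    linarith
  have key : ∀ t : ℝ, 0 ≤ t → ∀ i, δ * t / H * (B *ᵥ h) i ≤ δ * t := by
    intro t ht i
    calc δ * t / H * (B *ᵥ h) i ≤ δ * t / H * H :=
          mul_le_mul_of_nonneg_left (hle i) (by positivity)
      _ = δ * t := by field_simp
  -- By `h1` and `h2` each end has slack `δ` times a total mass. Since `(B *ᵥ h) i ≤ H`, dividing by
  -- `H` turns this slack into a multiple of `(B *ᵥ h) i`. The two gains add up to `δ * (hi - lo)`.
  refine ⟨lo + δ * (A - lo * H) / H, hi - δ * (hi * H - A) / H, by field_simp; ring, fun i => ?_⟩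
  have k1 := key _ (sub_nonneg.2 hA1) i
  have k2 := key _ (sub_nonneg.2 hA2) i
  rw [add_mul, sub_mul]
  constructor <;> linarith [h1 i, h2 i]

theorem mul_dotProduct_le {x a h : 𝓢 → ℝ} (hx : ∀ s, 0 ≤ x s) {lo : ℝ}
    (hlo : ∀ j, lo * h j ≤ a j) : lo * (x ⬝ᵥ h) ≤ x ⬝ᵥ a := by
  simp only [dotProduct, Finset.mul_sum]
  refine Finset.sum_le_sum fun j _ => ?_
  nlinarith [mul_le_mul_of_nonneg_left (hlo j) (hx j)]

theorem dotProduct_le_mul {x a h : 𝓢 → ℝ} (hx : ∀ s, 0 ≤ x s) {hi : ℝ}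
    (hhi : ∀ j, a j ≤ hi * h j) : x ⬝ᵥ a ≤ hi * (x ⬝ᵥ h) := by
  simp only [dotProduct, Finset.mul_sum]
  refine Finset.sum_le_sum fun j _ => ?_
  nlinarith [mul_le_mul_of_nonneg_left (hhi j) (hx j)]

/-- The quotients `x ⬝ a / x ⬝ h` for `x ≥ 0` lie in the range of the quotients `a j / h j`. -/
theorem abs_div_dotProduct_sub_le {x y a h : 𝓢 → ℝ} (hx : ∀ s, 0 ≤ x s) (hy : ∀ s, 0 ≤ y s)
    (hxh : 0 < x ⬝ᵥ h) (hyh : 0 < y ⬝ᵥ h) {lo hi : ℝ}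
    (hlo : ∀ j, lo * h j ≤ a j) (hhi : ∀ j, a j ≤ hi * h j) :
    |x ⬝ᵥ a / (x ⬝ᵥ h) - y ⬝ᵥ a / (y ⬝ᵥ h)| ≤ hi - lo := by
  have hx1 := (le_div_iff₀ hxh).2 (mul_dotProduct_le hx hlo)
  have hx2 := (div_le_iff₀ hxh).2 (dotProduct_le_mul hx hhi)
  have hy1 := (le_div_iff₀ hyh).2 (mul_dotProduct_le hy hlo)
  have hy2 := (div_le_iff₀ hyh).2 (dotProduct_le_mul hy hhi)
  rw [abs_le]
  constructor <;> linarith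

end Contraction

/-! ### Products of `D(z) P` along words -/

section Words

variable {𝓢 𝓩 : Type*} [Fintype 𝓢] [DecidableEq 𝓢]

/-- The substochastic matrix `D(z) P`. -/
def stepMatrix (P : Matrix 𝓢 𝓢 ℝ) (T : Matrix 𝓢 𝓩 ℝ) (z : 𝓩) : Matrix 𝓢 𝓢 ℝ :=
  Matrix.diagonal (fun k => T k z) * P

/-- The product `D(z₁) P ⋯ D(zₙ) P` along a word. -/
def wordMatrix (P : Matrix 𝓢 𝓢 ℝ) (T : Matrix 𝓢 𝓩 ℝ) (w : List 𝓩) : Matrix 𝓢 𝓢 ℝ :=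
  (w.map (stepMatrix P T)).prod

variable {P : Matrix 𝓢 𝓢 ℝ} {T : Matrix 𝓢 𝓩 ℝ}

theorem stepMatrix_apply (z : 𝓩) (s s' : 𝓢) : stepMatrix P T z s s' = T s z * P s s' := by
  simp [stepMatrix, Matrix.diagonal_mul]

@[simp] theorem wordMatrix_nil : wordMatrix P T [] = 1 := rfl

theorem wordMatrix_cons (z : 𝓩) (w : List 𝓩) :
    wordMatrix P T (z :: w) = stepMatrix P T z * wordMatrix P T w := by
  simp [wordMatrix]

theorem wordMatrix_append (u w : List 𝓩) :
    wordMatrix P T (u ++ w) = wordMatrix P T u * wordMatrix P T w := by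
  simp [wordMatrix]

theorem IsStochastic.pow (hP : IsStochastic P) (n : ℕ) : IsStochastic (P ^ n) := by
  induction n with
  | zero =>
    refine ⟨fun s t => ?_, fun s => by simp [Matrix.one_apply]⟩
    rw [pow_zero, Matrix.one_apply]
    split_ifs <;> norm_num
  | succ n ih =>
    rw [pow_succ]
    refine ⟨fun s t => Finset.sum_nonneg fun u _ => mul_nonneg (ih.1 s u) (hP.1 u t), fun s => ?_⟩
    have h1 : (P ^ n * P) *ᵥ 1 = 1 := by
      rw [← Matrix.mulVec_mulVec, hP.mulVec_one, ih.mulVec_one]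
    simpa [Matrix.mulVec, dotProduct] using congrFun h1 s

/-- Each letter scales the rows of `P` by factors in `[t, 1]`. Positivity of a power of `P` thus
passes to all words of that length, with one common bound. -/
theorem IsStochastic.wordMatrix_bounds (hP : IsStochastic P) {t : ℝ} (ht : 0 ≤ t)
    (htT : ∀ s z, t ≤ T s z) (hT1 : ∀ s z, T s z ≤ 1) (w : List 𝓩) (i j : 𝓢) :
    t ^ w.length * (P ^ w.length) i j ≤ wordMatrix P T w i j ∧
      wordMatrix P T w i j ≤ (P ^ w.length) i j := by
  induction w generalizing i with
  | nil => simp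
  | cons z w ih =>
    simp only [wordMatrix_cons, List.length_cons, pow_succ' P, Matrix.mul_apply,
      stepMatrix_apply, Finset.mul_sum]
    have hPn := (hP.pow w.length).1
    constructor <;> refine Finset.sum_le_sum fun k _ => ?_
    · calc t ^ (w.length + 1) * (P i k * (P ^ w.length) k j)
          = t * P i k * (t ^ w.length * (P ^ w.length) k j) := by ring
        _ ≤ T i z * P i k * wordMatrix P T w k j := by
          refine mul_le_mul (mul_le_mul_of_nonneg_right (htT i z) (hP.1 i k)) (ih k).1
            (mul_nonneg (pow_nonneg ht _) (hPn k j))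
            (mul_nonneg (ht.trans (htT i z)) (hP.1 i k))
    · have h0 : 0 ≤ wordMatrix P T w k j :=
        (mul_nonneg (pow_nonneg ht _) (hPn k j)).trans (ih k).1
      refine mul_le_mul ?_ (ih k).2 h0 (hP.1 i k)
      have := mul_le_mul_of_nonneg_right (hT1 i z) (hP.1 i k)
      rwa [one_mul] at this

theorem wordMatrix_mulVec_one_pos (hP : IsStochastic P) (hpos : ∀ s z, 0 < T s z) (w : List 𝓩)
    (i : 𝓢) : 0 < (wordMatrix P T w *ᵥ 1) i := by
  induction w generalizing i with
  | nil => simp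
  | cons z w ih =>
    rw [wordMatrix_cons, ← Matrix.mulVec_mulVec]
    simp only [Matrix.mulVec, dotProduct, stepMatrix_apply] at ih ⊢
    obtain ⟨k, hk⟩ : ∃ k, 0 < P i k := by
      by_contra! hneg
      have := Finset.sum_nonpos fun k (_ : k ∈ Finset.univ) => hneg k
      rw [hP.2 i] at this
      linarith
    exact Finset.sum_pos' (fun k _ => mul_nonneg (mul_nonneg (hpos i z).le (hP.1 i k)) (ih k).le)
      ⟨k, Finset.mem_univ k, mul_pos (mul_pos (hpos i z) hk) (ih k)⟩

theorem _root_.Matrix.IsPrimitive.exists_pow_bound (hprim : P.IsPrimitive) :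
    ∃ k : ℕ, ∃ δ > 0, ∀ i j, δ ≤ (P ^ k) i j := by
  obtain ⟨k, _, hk⟩ := hprim.exists_pos_pow
  rcases isEmpty_or_nonempty 𝓢 with he | hne
  · exact ⟨k, 1, one_pos, fun i => he.elim i⟩
  obtain ⟨m, hm⟩ := Finite.exists_min fun p : 𝓢 × 𝓢 => (P ^ k) p.1 p.2
  exact ⟨k, _, hk m.1 m.2, fun i j => hm (i, j)⟩

variable [Fintype 𝓩]

/-- Along words of length `N k`, the quotients of a column of the word matrix by its row sums lie
in an interval of length `(1 - δ) ^ N`. -/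
theorem exists_ratio_bounds_wordMatrix (hP : IsStochastic P) (hT : IsStochastic T)
    (hprim : P.IsPrimitive) (hpos : ∀ s z, 0 < T s z) :
    ∃ k : ℕ, ∃ δ > 0, δ ≤ 1 ∧ ∀ (N : ℕ) (w : List 𝓩), w.length = N * k → ∀ c : 𝓢,
      ∃ lo hi : ℝ, hi - lo = (1 - δ) ^ N ∧
        ∀ i, lo * (wordMatrix P T w *ᵥ 1) i ≤ (wordMatrix P T w *ᵥ Pi.single c 1) i ∧
          (wordMatrix P T w *ᵥ Pi.single c 1) i ≤ hi * (wordMatrix P T w *ᵥ 1) i := by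
  obtain ⟨k, δ, hδ, hk⟩ := hprim.exists_pow_bound
  obtain ⟨t, ht, htT⟩ := exists_emission_bound hpos
  -- The minimum with `1` keeps the contraction factor `1 - δ` nonnegative.
  refine ⟨k, min (t ^ k * δ) 1, by positivity, min_le_right _ _, fun N => ?_⟩
  induction N with
  | zero =>
    intro w hw c
    rw [zero_mul, List.length_eq_zero_iff] at hw
    subst hw
    refine ⟨0, 1, by simp, fun i => ?_⟩
    rw [wordMatrix_nil, Matrix.one_mulVec, Matrix.one_mulVec]
    by_cases hi : i = c
    · subst hi; simp
    · simp [hi]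
  | succ N ih =>
    intro w hw c
    -- The first `k` letters act on the left of the remaining product, contracting the interval
    -- already found for the suffix.
    have hu : (w.take k).length = k := by
      rw [List.length_take, hw, min_eq_left (by nlinarith)]
    have hv : (w.drop k).length = N * k := by
      rw [List.length_drop, hw, add_mul, one_mul, Nat.add_sub_cancel]
    obtain ⟨lo, hi, hlen, hb⟩ := ih _ hv c
    have hbd := hP.wordMatrix_bounds ht.le htT hT.le_one (w.take k)
    rw [hu] at hbd
    obtain ⟨lo', hi', hlen', hb'⟩ := exists_ratio_bounds_mulVec
      (B := wordMatrix P T (w.take k)) (δ := min (t ^ k * δ) 1)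
      (fun i j => (min_le_left _ _).trans ((mul_le_mul_of_nonneg_left (hk i j)
        (by positivity)).trans (hbd i j).1))
      (fun i j => (hbd i j).2.trans ((hP.pow k).le_one i j)) (by positivity)
      (wordMatrix_mulVec_one_pos hP hpos (w.drop k)) (fun j => (hb j).1) (fun j => (hb j).2)
    refine ⟨lo', hi', by rw [hlen', hlen, pow_succ'], fun i => ?_⟩
    have := hb' i
    rwa [Matrix.mulVec_mulVec, Matrix.mulVec_mulVec, ← wordMatrix_append,
      List.take_append_drop] at this

/-- The powers of a primitive stochastic matrix flatten every vector. -/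
theorem exists_pow_dotProduct_sub_le (hP : IsStochastic P) (hprim : P.IsPrimitive) (b : 𝓢 → ℝ)
    {ε : ℝ} (hε : 0 < ε) : ∃ m : ℕ, ∀ x ∈ stdSimplex ℝ 𝓢, ∀ y ∈ stdSimplex ℝ 𝓢,
      |x ⬝ᵥ (P ^ m *ᵥ b) - y ⬝ᵥ (P ^ m *ᵥ b)| ≤ ε := by
  obtain ⟨k, δ₀, hδ₀, hk⟩ := hprim.exists_pow_bound
  set δ := min δ₀ 1
  have hδ : 0 < δ := lt_min hδ₀ one_pos
  set C := ∑ s, |b s|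
  have hbC : ∀ s, |b s| ≤ C := fun s =>
    Finset.single_le_sum (f := fun s => |b s|) (fun _ _ => abs_nonneg _) (Finset.mem_univ s)
  have hbd : ∀ N : ℕ, ∃ lo hi : ℝ, hi - lo = (1 - δ) ^ N * (2 * C) ∧
      ∀ i, lo * (1 : 𝓢 → ℝ) i ≤ (P ^ (k * N) *ᵥ b) i ∧
        (P ^ (k * N) *ᵥ b) i ≤ hi * (1 : 𝓢 → ℝ) i := by
    intro N
    induction N with
    | zero =>
      refine ⟨-C, C, by ring, fun i => ?_⟩
      have := abs_le.1 (hbC i)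
      simpa using this
    | succ N ih =>
      obtain ⟨lo, hi, hlen, hb⟩ := ih
      -- The denominator vector is `1`, which `P ^ k` fixes, so the ratios are the entries
      -- themselves.
      obtain ⟨lo', hi', hlen', hb'⟩ := exists_ratio_bounds_mulVec (B := P ^ k) (δ := δ)
        (fun i j => (min_le_left _ _).trans (hk i j)) (hP.pow k).le_one hδ.le
        (h := 1) (fun _ => one_pos) (fun j => (hb j).1) (fun j => (hb j).2)
      refine ⟨lo', hi', by rw [hlen', hlen, pow_succ']; ring, fun i => ?_⟩
      have := hb' i
      rwa [(hP.pow k).mulVec_one, Matrix.mulVec_mulVec, ← pow_add, add_comm k,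
        ← mul_add_one] at this
  have hlim : Tendsto (fun N : ℕ => (1 - δ) ^ N * (2 * C)) atTop (𝓝 (0 * (2 * C))) :=
    (tendsto_pow_atTop_nhds_zero_of_lt_one (sub_nonneg.2 (min_le_right _ _))
      (by linarith)).mul_const _
  rw [zero_mul] at hlim
  obtain ⟨N, hN⟩ := (hlim.eventually_le_const hε).exists
  obtain ⟨lo, hi, hlen, hb⟩ := hbd N
  refine ⟨k * N, fun x hx y hy => ?_⟩
  have h1 : ∀ z ∈ stdSimplex ℝ 𝓢, z ⬝ᵥ (1 : 𝓢 → ℝ) = 1 := fun z hz => by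
    simpa [dotProduct] using hz.2
  have := abs_div_dotProduct_sub_le hx.1 hy.1 (by rw [h1 x hx]; exact one_pos)
    (by rw [h1 y hy]; exact one_pos) (fun j => (hb j).1) (fun j => (hb j).2)
  rw [h1 x hx, h1 y hy, div_one, div_one, hlen] at this
  exact this.trans hN

end Words

end HMP
namespace HMP

/-! ### The filter and flattening of dual iterates -/

section Filtering

theorem stdSimplex_dotProduct_one {𝓢 : Type*} [Fintype 𝓢] (x : stdSimplex ℝ 𝓢) : (x : 𝓢 → ℝ) ⬝ᵥ 1 = 1 := by
  simp [dotProduct]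

variable {𝓢 𝓩 : Type*} [Fintype 𝓢] [DecidableEq 𝓢] [Fintype 𝓩]
  {P : Matrix 𝓢 𝓢 ℝ} {T : Matrix 𝓢 𝓩 ℝ}

theorem isFeller_hmpIFS (hP : IsStochastic P) (hT : IsStochastic T) (hpos : ∀ s z, 0 < T s z) :
    (hmpIFS P T hP hT hpos).IsFeller where
  continuous_F z := continuous_eta P T hP hpos z
  continuous_q z := Continuous.subtype_mk ((continuous_apply z).comp
    (continuous_vecMul.comp continuous_subtype_val)) _

/-- The composition of the maps `η(z, ·)` along a word. -/
noncomputable def filterState (hP : IsStochastic P) (hpos : ∀ s z, 0 < T s z) :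
    List 𝓩 → stdSimplex ℝ 𝓢 → stdSimplex ℝ 𝓢
  | [], x => x
  | z :: w, x => filterState hP hpos w (eta P T hP hpos z x)

/-- The probability of observing a word when the state has law `x`. -/
noncomputable def wordProb (P : Matrix 𝓢 𝓢 ℝ) (T : Matrix 𝓢 𝓩 ℝ) (w : List 𝓩) (x : 𝓢 → ℝ) : ℝ :=
  x ⬝ᵥ (wordMatrix P T w *ᵥ 1)

theorem wordProb_pos {𝓩 : Type*} {T : Matrix 𝓢 𝓩 ℝ} (hP : IsStochastic P) (hpos : ∀ s z, 0 < T s z) (w : List 𝓩)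
    (x : stdSimplex ℝ 𝓢) : 0 < wordProb P T w x := by
  obtain ⟨s, hs⟩ : ∃ s, 0 < (x : 𝓢 → ℝ) s := by
    by_contra! hneg
    have := Finset.sum_nonpos fun k (_ : k ∈ Finset.univ) => hneg k
    rw [stdSimplex.sum_eq_one x] at this
    linarith
  exact Finset.sum_pos'
    (fun k _ => mul_nonneg (x.2.1 k) (wordMatrix_mulVec_one_pos hP hpos w k).le)
    ⟨s, Finset.mem_univ s, mul_pos hs (wordMatrix_mulVec_one_pos hP hpos w s)⟩

/-- The probability `q z x` is exactly the normalising constant of `η(z, x)`; their product is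
therefore linear in `x`. -/
theorem q_mul_eta_dotProduct (hP : IsStochastic P) (hT : IsStochastic T)
    (hpos : ∀ s z, 0 < T s z) (z : 𝓩) (x : stdSimplex ℝ 𝓢) (b : 𝓢 → ℝ) :
    ((hmpIFS P T hP hT hpos).q z x : ℝ) * ((eta P T hP hpos z x : 𝓢 → ℝ) ⬝ᵥ b)
      = (x : 𝓢 → ℝ) ⬝ᵥ (stepMatrix P T z *ᵥ b) := by
  have hq : ((hmpIFS P T hP hT hpos).q z x : ℝ)
      = ((x : 𝓢 → ℝ) ᵥ* Matrix.diagonal fun k => T k z) ⬝ᵥ 1 := by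
    change ((x : 𝓢 → ℝ) ᵥ* T) z = _
    simp only [dotProduct, Matrix.vecMul_diagonal, Pi.one_apply, mul_one]
    rfl
  have hd : 0 < ((x : 𝓢 → ℝ) ᵥ* Matrix.diagonal fun k => T k z) ⬝ᵥ 1 := denom_pos hpos z x.2
  change _ * (etaVec P T z x ⬝ᵥ b) = _
  rw [hq, etaVec, smul_dotProduct, smul_eq_mul, mul_inv_cancel_left₀ hd.ne', stepMatrix,
    Matrix.vecMul_vecMul, ← Matrix.dotProduct_mulVec]

theorem q_eq_dotProduct (hP : IsStochastic P) (hT : IsStochastic T)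
    (hpos : ∀ s z, 0 < T s z) (z : 𝓩) (x : stdSimplex ℝ 𝓢) :
    ((hmpIFS P T hP hT hpos).q z x : ℝ) = (x : 𝓢 → ℝ) ⬝ᵥ (stepMatrix P T z *ᵥ 1) := by
  rw [← q_mul_eta_dotProduct hP hT hpos, stdSimplex_dotProduct_one, mul_one]

theorem wordProb_cons (hP : IsStochastic P) (hT : IsStochastic T)
    (hpos : ∀ s z, 0 < T s z) (z : 𝓩) (w : List 𝓩) (x : stdSimplex ℝ 𝓢) :
    wordProb P T (z :: w) x
      = (hmpIFS P T hP hT hpos).q z x * wordProb P T w (eta P T hP hpos z x) := by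
  rw [wordProb, wordProb, wordMatrix_cons, q_mul_eta_dotProduct, Matrix.mulVec_mulVec]

/-- The normalising constants along the word multiply to its probability, so they all cancel. -/
theorem wordProb_mul_filterState_dotProduct (hP : IsStochastic P) (hT : IsStochastic T)
    (hpos : ∀ s z, 0 < T s z) (w : List 𝓩) (x : stdSimplex ℝ 𝓢) (b : 𝓢 → ℝ) :
    wordProb P T w x * ((filterState hP hpos w x : 𝓢 → ℝ) ⬝ᵥ b)
      = (x : 𝓢 → ℝ) ⬝ᵥ (wordMatrix P T w *ᵥ b) := by
  induction w generalizing x with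
  | nil => simp [wordProb, filterState, stdSimplex_dotProduct_one]
  | cons z w ih =>
    rw [wordProb_cons hP hT hpos, filterState, mul_assoc, ih, q_mul_eta_dotProduct,
      wordMatrix_cons, Matrix.mulVec_mulVec]

/-- Puts the filter in the ratio form to which the contraction estimate applies. -/
theorem filterState_apply (hP : IsStochastic P) (hT : IsStochastic T)
    (hpos : ∀ s z, 0 < T s z) (w : List 𝓩) (x : stdSimplex ℝ 𝓢) (c : 𝓢) :
    (filterState hP hpos w x : 𝓢 → ℝ) c
      = (x : 𝓢 → ℝ) ⬝ᵥ (wordMatrix P T w *ᵥ Pi.single c 1) / wordProb P T w x := by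
  rw [eq_div_iff (wordProb_pos hP hpos w x).ne', mul_comm,
    ← wordProb_mul_filterState_dotProduct hP hT hpos, dotProduct_single, mul_one]

theorem wordProb_append_singleton (hP : IsStochastic P) (hT : IsStochastic T)
    (hpos : ∀ s z, 0 < T s z) (z : 𝓩) (w : List 𝓩) (x : stdSimplex ℝ 𝓢) :
    wordProb P T (w ++ [z]) x
      = wordProb P T w x * zeta T hT (filterState hP hpos w x) z := by
  change _ = _ * ((hmpIFS P T hP hT hpos).q z (filterState hP hpos w x) : ℝ)
  rw [q_eq_dotProduct, wordProb_mul_filterState_dotProduct hP hT hpos, wordProb,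
    wordMatrix_append, Matrix.mulVec_mulVec, wordMatrix_cons, wordMatrix_nil, mul_one]

theorem dual_iterate_eq_sum (hP : IsStochastic P) (hT : IsStochastic T)
    (hpos : ∀ s z, 0 < T s z) (f : stdSimplex ℝ 𝓢 → ℝ) (n : ℕ) (x : stdSimplex ℝ 𝓢) :
    (hmpIFS P T hP hT hpos).dual^[n] f x = ∑ w : Fin n → 𝓩,
      wordProb P T (List.ofFn w) x * f (filterState hP hpos (List.ofFn w) x) := by
  induction n generalizing x with
  | zero => simp [filterState, wordProb, stdSimplex_dotProduct_one]
  | succ n ih =>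
    rw [Function.iterate_succ_apply', IFS.dual, ← (Fin.consEquiv fun _ => 𝓩).sum_comp,
      Fintype.sum_prod_type]
    refine Finset.sum_congr rfl fun z _ => ?_
    rw [ih, Finset.mul_sum]
    refine Finset.sum_congr rfl fun w _ => ?_
    have : List.ofFn (Fin.consEquiv (fun _ => 𝓩) (z, w)) = z :: List.ofFn w := by
      simp [Fin.consEquiv, List.ofFn_succ]
    rw [this, wordProb_cons hP hT hpos, filterState, mul_assoc]
    rfl

theorem sum_wordProb (hP : IsStochastic P) (hT : IsStochastic T)
    (hpos : ∀ s z, 0 < T s z) (n : ℕ) (x : stdSimplex ℝ 𝓢) :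
    ∑ w : Fin n → 𝓩, wordProb P T (List.ofFn w) x = 1 := by
  have := dual_iterate_eq_sum hP hT hpos (fun _ => 1) n x
  rw [IFS.dual_iterate_const] at this
  simpa using this.symm

/-- On linear functions, the dual operator acts through the transition matrix. -/
theorem dual_iterate_dotProduct (hP : IsStochastic P) (hT : IsStochastic T)
    (hpos : ∀ s z, 0 < T s z) (b : 𝓢 → ℝ) (n : ℕ) :
    (hmpIFS P T hP hT hpos).dual^[n] (fun x : stdSimplex ℝ 𝓢 => (x : 𝓢 → ℝ) ⬝ᵥ b)
      = fun x : stdSimplex ℝ 𝓢 => (x : 𝓢 → ℝ) ⬝ᵥ (P ^ n *ᵥ b) := by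
  induction n with
  | zero => simp
  | succ n ih =>
    rw [Function.iterate_succ_apply', ih]
    funext x
    simp only [IFS.dual]
    -- Averaging over the observation leaves only the transition, because the rows of `T` sum to
    -- `1`.
    have hsum : ∑ z, stepMatrix P T z = P := by
      ext s s'
      simp only [Matrix.sum_apply, stepMatrix_apply, ← Finset.sum_mul, hT.2, one_mul]
    calc ∑ z, ((hmpIFS P T hP hT hpos).q z x : ℝ) *
          ((eta P T hP hpos z x : 𝓢 → ℝ) ⬝ᵥ (P ^ n *ᵥ b))
        = ∑ z, (x : 𝓢 → ℝ) ⬝ᵥ (stepMatrix P T z *ᵥ (P ^ n *ᵥ b)) :=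
          Finset.sum_congr rfl fun z _ => q_mul_eta_dotProduct hP hT hpos z x _
      _ = (x : 𝓢 → ℝ) ⬝ᵥ (P ^ (n + 1) *ᵥ b) := by
          rw [← dotProduct_sum, ← Matrix.sum_mulVec, hsum, Matrix.mulVec_mulVec, pow_succ']

/-- Filters started from different laws merge, uniformly in the observed word. -/
theorem exists_forall_abs_filterState_sub_le (hP : IsStochastic P) (hT : IsStochastic T)
    (hprim : P.IsPrimitive) (hpos : ∀ s z, 0 < T s z) {f : stdSimplex ℝ 𝓢 → ℝ}
    (hf : Continuous f) {ε : ℝ} (hε : 0 < ε) :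
    ∃ l : ℕ, ∀ w : List 𝓩, w.length = l → ∀ x y,
      |f (filterState hP hpos w x) - f (filterState hP hpos w y)| ≤ ε := by
  obtain ⟨k, δ, hδ, hδ1, hk⟩ := exists_ratio_bounds_wordMatrix hP hT hprim hpos
  obtain ⟨η, hη, hfη⟩ := Metric.uniformContinuous_iff.1
    (CompactSpace.uniformContinuous_of_continuous hf) ε hε
  obtain ⟨N, hN⟩ := exists_pow_lt_of_lt_one hη (by linarith : 1 - δ < 1)
  refine ⟨N * k, fun w hw x y => ?_⟩
  rw [← Real.dist_eq]
  refine (hfη (lt_of_le_of_lt ?_ hN)).le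
  rw [Subtype.dist_eq, dist_pi_le_iff (pow_nonneg (sub_nonneg.2 hδ1) _)]
  intro c
  obtain ⟨lo, hi, hlen, hb⟩ := hk N w hw c
  rw [Real.dist_eq]
  change |filterState hP hpos w x c - filterState hP hpos w y c| ≤ _
  rw [filterState_apply hP hT, filterState_apply hP hT, ← hlen]
  exact abs_div_dotProduct_sub_le x.2.1 y.2.1 (wordProb_pos hP hpos w x) (wordProb_pos hP hpos w y)
    (fun j => (hb j).1) (fun j => (hb j).2)

/-- After `l` letters the filter may be restarted from a fixed `y₀` at cost `ε / 3`; only the word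
probabilities, linear in `x`, still depend on `x`. A further `m` dual steps preserve this error and
replace `b` by `P ^ m *ᵥ b`, flat up to `ε / 3`. -/
theorem exists_dual_iterate_sub_le (hP : IsStochastic P) (hT : IsStochastic T)
    (hprim : P.IsPrimitive) (hpos : ∀ s z, 0 < T s z) {f : stdSimplex ℝ 𝓢 → ℝ}
    (hf : Continuous f) {ε : ℝ} (hε : 0 < ε) :
    ∃ n, ∀ x y, |(hmpIFS P T hP hT hpos).dual^[n] f x
      - (hmpIFS P T hP hT hpos).dual^[n] f y| ≤ ε := by
  rcases isEmpty_or_nonempty (stdSimplex ℝ 𝓢) with he | ⟨⟨y₀⟩⟩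
  · exact ⟨0, fun x => he.elim x⟩
  obtain ⟨l, hl⟩ := exists_forall_abs_filterState_sub_le hP hT hprim hpos hf
    (by positivity : 0 < ε / 3)
  set b : 𝓢 → ℝ := ∑ w : Fin l → 𝓩,
    f (filterState hP hpos (List.ofFn w) y₀) • (wordMatrix P T (List.ofFn w) *ᵥ 1)
  have hlin : ∀ x : stdSimplex ℝ 𝓢,
      |(hmpIFS P T hP hT hpos).dual^[l] f x - (x : 𝓢 → ℝ) ⬝ᵥ b| ≤ ε / 3 := by
    intro x
    rw [dual_iterate_eq_sum, dotProduct_sum, ← Finset.sum_sub_distrib]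
    calc _ ≤ ∑ w : Fin l → 𝓩, wordProb P T (List.ofFn w) x * (ε / 3) := by
          refine (Finset.abs_sum_le_sum_abs _ _).trans (Finset.sum_le_sum fun w _ => ?_)
          rw [dotProduct_smul, smul_eq_mul, mul_comm (f _) (_ ⬝ᵥ _)]
          change |_ - wordProb P T (List.ofFn w) x * _| ≤ _
          have hp := (wordProb_pos hP hpos (List.ofFn w) x).le
          rw [← mul_sub, abs_mul, abs_of_nonneg hp]
          exact mul_le_mul_of_nonneg_left (hl _ List.length_ofFn _ _) hp
      _ = ε / 3 := by rw [← Finset.sum_mul, sum_wordProb hP hT hpos, one_mul]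
  obtain ⟨m, hm⟩ := exists_pow_dotProduct_sub_le hP hprim b (by positivity : 0 < ε / 3)
  have happrox := (hmpIFS P T hP hT hpos).abs_dual_iterate_sub_le hlin m
  rw [dual_iterate_dotProduct] at happrox
  refine ⟨m + l, fun x y => ?_⟩
  rw [Function.iterate_add_apply]
  have h1 := abs_le.1 (happrox x)
  have h2 := abs_le.1 (happrox y)
  have h3 := abs_le.1 (hm x x.2 y y.2)
  rw [abs_le]
  constructor <;> linarith [h1.1, h1.2, h2.1, h2.2, h3.1, h3.2]

theorem exists_isAttractive_hmpIFS [Nonempty (stdSimplex ℝ 𝓢)] (hP : IsStochastic P)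
    (hT : IsStochastic T) (hprim : P.IsPrimitive) (hpos : ∀ s z, 0 < T s z) :
    ∃ μ, (hmpIFS P T hP hT hpos).IsAttractive μ :=
  (isFeller_hmpIFS hP hT hpos).exists_isAttractive fun _ hf _ hε =>
    exists_dual_iterate_sub_le hP hT hprim hpos hf hε

end Filtering

end HMP
namespace HMP

/-! ### Finite blocks and elementary conditioning -/

section Blocks

variable {Ω γ : Type*}

theorem block_eq_iff {X : ℕ → Ω → γ} {n : ℕ} {ω : Ω} {x : ℕ → γ} :
    block X (n + 1) ω = (fun i : Fin (n + 1) => x i) ↔ ∀ i ≤ n, X i ω = x i := by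
  rw [funext_iff]
  exact ⟨fun h i hi => h ⟨i, Nat.lt_succ_of_le hi⟩, fun h i => h i (Nat.le_of_lt_succ i.2)⟩

theorem block_succ_eq_snoc_iff {X : ℕ → Ω → γ} {n : ℕ} {ω : Ω} {w : Fin n → γ} {x : γ} :
    block X (n + 1) ω = Fin.snoc (α := fun _ => γ) w x ↔ block X n ω = w ∧ X n ω = x := by
  simp only [funext_iff, Fin.forall_fin_succ', Fin.snoc_castSucc, Fin.snoc_last]
  rfl

/-- The process identities quantify over infinite sequences; the values chosen beyond index `n` play
no role. -/
theorem exists_extension {n : ℕ} (w : Fin (n + 1) → γ) :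
    ∃ x : ℕ → γ, w = fun i : Fin (n + 1) => x i :=
  ⟨fun i => w (Fin.ofNat (n + 1) i), by funext i; simp⟩

theorem sum_snoc [Fintype γ] {n : ℕ} {M : Type*} [AddCommMonoid M] (f : (Fin (n + 1) → γ) → M) :
    ∑ v, f v = ∑ w : Fin n → γ, ∑ x, f (Fin.snoc (α := fun _ => γ) w x) := by
  rw [← (Fin.snocEquiv fun _ => γ).sum_comp, Fintype.sum_prod_type, Finset.sum_comm]
  rfl

theorem ofFn_snoc {n : ℕ} (w : Fin n → γ) (x : γ) :
    List.ofFn (Fin.snoc (α := fun _ => γ) w x) = List.ofFn w ++ [x] := by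
  rw [List.ofFn_succ', List.concat_eq_append]
  simp

end Blocks

section FiniteProbability

variable {Ω : Type*} [MeasurableSpace Ω]

theorem real_eq_sum_and {β : Type*} [Fintype β] (ℙ : Measure Ω) [IsFiniteMeasure ℙ] {p : Ω → Prop}
    (hp : MeasurableSet {ω | p ω}) {Y : Ω → β} (hY : ∀ y, MeasurableSet {ω | Y ω = y}) :
    ℙ.real {ω | p ω} = ∑ y, ℙ.real {ω | p ω ∧ Y ω = y} := by
  have : {ω | p ω} = ⋃ y, {ω | p ω ∧ Y ω = y} := by ext ω; simp
  rw [this]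
  refine measureReal_iUnion_fintype ?_ fun y => hp.inter (hY y)
  intro y y' hne
  exact Set.disjoint_left.2 fun ω h1 h2 => hne (h1.2.symm.trans h2.2)

theorem real_cond (ℙ : Measure Ω) {A : Set Ω} (hA : MeasurableSet A) (B : Set Ω) :
    (ProbabilityTheory.cond ℙ A).real B = (ℙ.real A)⁻¹ * ℙ.real (A ∩ B) := by
  simp [measureReal_def, ProbabilityTheory.cond_apply hA, ENNReal.toReal_mul, ENNReal.toReal_inv]

/-- In product form the identity needs no positivity: both sides vanish when `A` is null. -/
theorem real_inter_of_cond (ℙ : Measure Ω) [IsFiniteMeasure ℙ] {A : Set Ω} (hA : MeasurableSet A)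
    {B : Set Ω} {c : ℝ} (h : ℙ A ≠ 0 → (ProbabilityTheory.cond ℙ A).real B = c) :
    ℙ.real (A ∩ B) = ℙ.real A * c := by
  by_cases h0 : ℙ A = 0
  · simp [measureReal_def, h0, measure_mono_null Set.inter_subset_left h0]
  · rw [← h h0, real_cond ℙ hA, mul_inv_cancel_left₀]
    simpa [measureReal_def, ENNReal.toReal_eq_zero_iff] using h0

variable {γ : Type*}

theorem measurableSet_block_eq [Finite γ] [MeasurableSpace γ] [MeasurableSingletonClass γ]
    {X : ℕ → Ω → γ} (hX : ∀ n, Measurable (X n)) (n : ℕ) (w : Fin n → γ) :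
    MeasurableSet {ω | block X n ω = w} :=
  measurableSet_eq_fun (measurable_pi_lambda _ fun i => hX i) measurable_const

end FiniteProbability

/-! ### Laws and entropies of the hidden Markov process -/

namespace IsHiddenMarkovProcess

variable {Ω 𝓢 𝓩 : Type*} [MeasurableSpace Ω]
  [Fintype 𝓢] [MeasurableSpace 𝓢] [MeasurableSingletonClass 𝓢] [MeasurableSpace 𝓩]
  {ℙ : Measure Ω} [IsProbabilityMeasure ℙ] {P : Matrix 𝓢 𝓢 ℝ} {T : Matrix 𝓢 𝓩 ℝ}
  {S : ℕ → Ω → 𝓢} {Z : ℕ → Ω → 𝓩}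

theorem real_blocks (hSZ : IsHiddenMarkovProcess ℙ P T S Z) {n : ℕ} (s : Fin (n + 1) → 𝓢)
    (z : Fin (n + 1) → 𝓩) :
    ℙ.real {ω | block S (n + 1) ω = s ∧ block Z (n + 1) ω = z}
      = ℙ.real {ω | block S (n + 1) ω = s} * ∏ i, T (s i) (z i) := by
  have hm := measurableSet_block_eq hSZ.measurable_state (n + 1) s
  obtain ⟨s, rfl⟩ := exists_extension s
  obtain ⟨z, rfl⟩ := exists_extension z
  simp only [block_eq_iff] at hm ⊢
  rw [← Finset.prod_range fun i => T (s i) (z i)]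
  exact real_inter_of_cond ℙ hm (hSZ.memoryless n s z)

variable [Fintype 𝓩] [MeasurableSingletonClass 𝓩]

theorem real_obs_state_succ (hSZ : IsHiddenMarkovProcess ℙ P T S Z) {n : ℕ}
    (v : Fin (n + 1) → 𝓩) (s' : 𝓢) :
    ℙ.real {ω | block Z (n + 1) ω = v ∧ S (n + 1) ω = s'}
      = ∑ s, ℙ.real {ω | S n ω = s ∧ block Z (n + 1) ω = v} * P s s' := by
  have hS : ∀ k s, MeasurableSet {ω | S k ω = s} := fun k s =>
    hSZ.measurable_state k (measurableSet_singleton s)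
  have hZ := measurableSet_block_eq hSZ.measurable_obs (n + 1) v
  refine (real_eq_sum_and ℙ (hZ.inter (hS (n + 1) s')) (hS n)).trans ?_
  refine Finset.sum_congr rfl fun s _ => ?_
  have hm : MeasurableSet {ω | S n ω = s ∧ block Z (n + 1) ω = v} := (hS n s).inter hZ
  have e : {ω | (block Z (n + 1) ω = v ∧ S (n + 1) ω = s') ∧ S n ω = s}
      = {ω | S n ω = s ∧ block Z (n + 1) ω = v} ∩ {ω | S (n + 1) ω = s'} := by
    ext ω
    simp only [Set.mem_ofPred_eq, Set.mem_inter_iff]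
    tauto
  refine (congrArg ℙ.real e).trans ?_
  obtain ⟨z, rfl⟩ := exists_extension v
  simp only [block_eq_iff] at hm ⊢
  exact real_inter_of_cond ℙ hm (hSZ.sufficient n s s' z)

/-- The memoryless identity pairs blocks of equal length. Summing out the last observation leaves
one more state than observations. -/
theorem real_states_blocks_init (hSZ : IsHiddenMarkovProcess ℙ P T S Z) (hT : IsStochastic T)
    {n : ℕ} (s : Fin (n + 1) → 𝓢) (w : Fin n → 𝓩) :
    ℙ.real {ω | block S (n + 1) ω = s ∧ block Z n ω = w}
      = ℙ.real {ω | block S (n + 1) ω = s} * ∏ i : Fin n, T (s i.castSucc) (w i) := by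
  refine (real_eq_sum_and ℙ ((measurableSet_block_eq hSZ.measurable_state _ s).inter
    (measurableSet_block_eq hSZ.measurable_obs _ w)) (Y := Z n)
    fun y => hSZ.measurable_obs n (measurableSet_singleton y)).trans ?_
  change ∑ y, ℙ.real {ω | (block S (n + 1) ω = s ∧ block Z n ω = w) ∧ Z n ω = y} = _
  simp only [and_assoc, ← block_succ_eq_snoc_iff, hSZ.real_blocks, Fin.prod_univ_castSucc,
    Fin.snoc_castSucc, Fin.snoc_last, ← Finset.mul_sum, hT.2, mul_one]

/-- Given the past observations and the present state, the observation has law `T s`. -/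
theorem real_state_obs_snoc (hSZ : IsHiddenMarkovProcess ℙ P T S Z) (hT : IsStochastic T)
    {n : ℕ} (s : 𝓢) (w : Fin n → 𝓩) (z : 𝓩) :
    ℙ.real {ω | S n ω = s ∧ block Z (n + 1) ω = Fin.snoc (α := fun _ => 𝓩) w z}
      = ℙ.real {ω | block Z n ω = w ∧ S n ω = s} * T s z := by
  have hS := hSZ.measurable_state n (measurableSet_singleton s)
  have h1 := real_eq_sum_and ℙ (hS.inter (measurableSet_block_eq hSZ.measurable_obs (n + 1)
    (Fin.snoc (α := fun _ => 𝓩) w z))) (measurableSet_block_eq hSZ.measurable_state n)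
  have h2 := real_eq_sum_and ℙ ((measurableSet_block_eq hSZ.measurable_obs n w).inter hS)
    (measurableSet_block_eq hSZ.measurable_state n)
  refine h1.trans (Eq.trans ?_ (congrArg (· * T s z) h2.symm))
  -- Both sides are now sums over state histories `u`, and for each `u` the product formulas differ
  -- by the last factor `T s z`.
  rw [Finset.sum_mul]
  refine Finset.sum_congr rfl fun u _ => ?_
  have e1 : {ω | (S n ω = s ∧ block Z (n + 1) ω = Fin.snoc (α := fun _ => 𝓩) w z) ∧
      block S n ω = u} = {ω | block S (n + 1) ω = Fin.snoc (α := fun _ => 𝓢) u s ∧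
      block Z (n + 1) ω = Fin.snoc (α := fun _ => 𝓩) w z} := by
    ext ω
    simp only [Set.mem_ofPred_eq, block_succ_eq_snoc_iff (X := S)]
    tauto
  have e2 : {ω | (block Z n ω = w ∧ S n ω = s) ∧ block S n ω = u}
      = {ω | block S (n + 1) ω = Fin.snoc (α := fun _ => 𝓢) u s ∧ block Z n ω = w} := by
    ext ω
    simp only [Set.mem_ofPred_eq, block_succ_eq_snoc_iff (X := S)]
    tauto
  refine (congrArg ℙ.real e1).trans (Eq.trans ?_ (congrArg (ℙ.real · * T s z) e2.symm))
  rw [hSZ.real_blocks, hSZ.real_states_blocks_init hT, Fin.prod_univ_castSucc]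
  simp only [Fin.snoc_castSucc, Fin.snoc_last, mul_assoc]

variable [DecidableEq 𝓢]

/-- The law of the initial state. -/
noncomputable def initialLaw (hSZ : IsHiddenMarkovProcess ℙ P T S Z) : stdSimplex ℝ 𝓢 :=
  ⟨fun s => ℙ.real {ω | S 0 ω = s}, fun _ => measureReal_nonneg, by
    have := real_eq_sum_and ℙ (p := fun _ => True) MeasurableSet.univ
      (Y := S 0) fun s => hSZ.measurable_state 0 (measurableSet_singleton s)
    simpa using this.symm⟩

/-- The forward formula for the joint law of the past observations and the present state. -/
theorem real_obs_state (hSZ : IsHiddenMarkovProcess ℙ P T S Z) (hT : IsStochastic T) {n : ℕ}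
    (w : Fin n → 𝓩) (s : 𝓢) :
    ℙ.real {ω | block Z n ω = w ∧ S n ω = s}
      = ((hSZ.initialLaw : 𝓢 → ℝ) ᵥ* wordMatrix P T (List.ofFn w)) s := by
  induction n generalizing s with
  | zero =>
    simp only [Subsingleton.elim _ w, true_and, List.ofFn_zero, wordMatrix_nil, Matrix.vecMul_one]
    rfl
  | succ n ih =>
    obtain ⟨⟨z, w⟩, rfl⟩ := (Fin.snocEquiv fun _ => 𝓩).surjective w
    change ℙ.real {ω | block Z (n + 1) ω = Fin.snoc (α := fun _ => 𝓩) w z ∧ _} =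
      (_ ᵥ* wordMatrix P T (List.ofFn (Fin.snoc (α := fun _ => 𝓩) w z))) s
    rw [ofFn_snoc, wordMatrix_append, ← Matrix.vecMul_vecMul, hSZ.real_obs_state_succ]
    simp only [hSZ.real_state_obs_snoc hT, ih, wordMatrix_cons, wordMatrix_nil, mul_one]
    simp only [Matrix.vecMul, dotProduct, stepMatrix_apply, mul_assoc]

/-- Identifies the filter with the conditional law of the state: the forward formula is divided by
the word probability. -/
theorem real_obs_state_eq_mul (hSZ : IsHiddenMarkovProcess ℙ P T S Z) (hP : IsStochastic P)
    (hT : IsStochastic T) (hpos : ∀ s z, 0 < T s z) {n : ℕ} (w : Fin n → 𝓩) (s : 𝓢) :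
    ℙ.real {ω | block Z n ω = w ∧ S n ω = s}
      = wordProb P T (List.ofFn w) hSZ.initialLaw *
        filterState hP hpos (List.ofFn w) hSZ.initialLaw s := by
  rw [filterState_apply hP hT, mul_div_cancel₀ _ (wordProb_pos hP hpos _ _).ne',
    hSZ.real_obs_state hT, Matrix.dotProduct_mulVec, dotProduct_single, mul_one]

theorem real_obs (hSZ : IsHiddenMarkovProcess ℙ P T S Z) (hP : IsStochastic P)
    (hT : IsStochastic T) (hpos : ∀ s z, 0 < T s z) {n : ℕ} (w : Fin n → 𝓩) :
    ℙ.real {ω | block Z n ω = w} = wordProb P T (List.ofFn w) hSZ.initialLaw := by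
  rw [real_eq_sum_and ℙ (measurableSet_block_eq hSZ.measurable_obs n w)
    fun s => hSZ.measurable_state n (measurableSet_singleton s)]
  simp only [hSZ.real_obs_state_eq_mul hP hT hpos, ← Finset.mul_sum, stdSimplex.sum_eq_one,
    mul_one]

theorem condEntropy_eq (hSZ : IsHiddenMarkovProcess ℙ P T S Z) (hP : IsStochastic P)
    (hT : IsStochastic T) (hpos : ∀ s z, 0 < T s z) (n : ℕ) :
    condEntropy ℙ (S n) (block Z n)
      = (hmpIFS P T hP hT hpos).dual^[n] (fun x => h x) hSZ.initialLaw := by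
  rw [dual_iterate_eq_sum, condEntropy]
  refine Finset.sum_congr rfl fun w _ => ?_
  rw [hSZ.real_obs hP hT hpos]
  congr 2
  funext s
  rw [real_cond ℙ (measurableSet_block_eq hSZ.measurable_obs n w), hSZ.real_obs hP hT hpos]
  change _ * ℙ.real {ω | block Z n ω = w ∧ S n ω = s} = _
  rw [hSZ.real_obs_state_eq_mul hP hT hpos,
    inv_mul_cancel_left₀ (wordProb_pos hP hpos _ _).ne']

/-- The chain rule: given the word, the next observation has law `ζ` of the filter, and `negMulLog
(p * q)` splits as `q * negMulLog p + p * negMulLog q`. -/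
theorem entropy_block_succ (hSZ : IsHiddenMarkovProcess ℙ P T S Z) (hP : IsStochastic P)
    (hT : IsStochastic T) (hpos : ∀ s z, 0 < T s z) (n : ℕ) :
    entropy ℙ (block Z (n + 1)) = entropy ℙ (block Z n)
      + (hmpIFS P T hP hT hpos).dual^[n] (fun x => h (zeta T hT x)) hSZ.initialLaw := by
  rw [dual_iterate_eq_sum, entropy, entropy, h, h, sum_snoc, ← Finset.sum_add_distrib]
  refine Finset.sum_congr rfl fun w _ => ?_
  simp only [hSZ.real_obs hP hT hpos, ofFn_snoc, wordProb_append_singleton hP hT hpos,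
    Real.negMulLog_mul, Finset.sum_add_distrib, ← Finset.sum_mul, ← Finset.mul_sum,
    stdSimplex.sum_eq_one, one_mul, h]

theorem entropy_block_eq_sum (hSZ : IsHiddenMarkovProcess ℙ P T S Z) (hP : IsStochastic P)
    (hT : IsStochastic T) (hpos : ∀ s z, 0 < T s z) (n : ℕ) :
    entropy ℙ (block Z n) = ∑ k ∈ Finset.range n,
      (hmpIFS P T hP hT hpos).dual^[k] (fun x => h (zeta T hT x)) hSZ.initialLaw := by
  induction n with
  | zero =>
    rw [entropy, h, Finset.univ_unique, Finset.sum_singleton, hSZ.real_obs hP hT hpos]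
    simp [wordProb, stdSimplex_dotProduct_one]
  | succ n ih => rw [hSZ.entropy_block_succ hP hT hpos, ih, Finset.sum_range_succ]

end IsHiddenMarkovProcess

theorem continuous_h {α : Type*} [Fintype α] : Continuous (h : (α → ℝ) → ℝ) :=
  continuous_finsetSum _ fun i _ => Real.continuous_negMulLog.comp (continuous_apply i)

theorem tendsto_one_div_mul_sum_range_succ {a : ℕ → ℝ} {c : ℝ} (ha : Tendsto a atTop (𝓝 c)) :
    Tendsto (fun n : ℕ => (1 / (n : ℝ)) * ∑ k ∈ Finset.range (n + 1), a k) atTop (𝓝 c) := by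
  -- There are `n + 1` terms but the divisor is `n`; the surplus term `a n / n` tends to zero.
  have h1 := ha.cesaro.add ((tendsto_inv_atTop_nhds_zero_nat (𝕜 := ℝ)).mul ha)
  rw [zero_mul, add_zero] at h1
  refine h1.congr fun n => ?_
  rw [Finset.sum_range_succ, one_div, mul_add]

end HMP

theorem theorem1 {Ω 𝓢 𝓩 : Type*} [MeasurableSpace Ω]
    [Fintype 𝓢] [DecidableEq 𝓢] [MeasurableSpace 𝓢] [MeasurableSingletonClass 𝓢]
    [Fintype 𝓩] [MeasurableSpace 𝓩] [MeasurableSingletonClass 𝓩]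
    (ℙ : Measure Ω) [IsProbabilityMeasure ℙ]
    (P : Matrix 𝓢 𝓢 ℝ) (T : Matrix 𝓢 𝓩 ℝ)
    (hP : HMP.IsStochastic P) (hT : HMP.IsStochastic T)
    (hprim : P.IsPrimitive)
    (hpos : ∀ s z, 0 < T s z)
    (S : ℕ → Ω → 𝓢) (Z : ℕ → Ω → 𝓩) (hSZ : HMP.IsHiddenMarkovProcess ℙ P T S Z) :
    (∃ μ : ProbabilityMeasure (stdSimplex ℝ 𝓢),
      (HMP.hmpIFS P T hP hT hpos).IsAttractive μ ∧
        (HMP.hmpIFS P T hP hT hpos).IsInvariant μ) ∧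
    ∀ μ : ProbabilityMeasure (stdSimplex ℝ 𝓢),
      (HMP.hmpIFS P T hP hT hpos).IsAttractive μ →
      (HMP.hmpIFS P T hP hT hpos).IsInvariant μ →
        HMP.HasEntropyRate ℙ Z
            (∫ x, HMP.h (HMP.zeta T hT x) ∂(μ : Measure (stdSimplex ℝ 𝓢))) ∧
          HMP.HasEstimationEntropy ℙ S Z
            (∫ x, HMP.h x ∂(μ : Measure (stdSimplex ℝ 𝓢))) := by
  have hF := HMP.isFeller_hmpIFS hP hT hpos
  -- The law of `S 0` is a point of the simplex.
  have hne : Nonempty (stdSimplex ℝ 𝓢) := ⟨hSZ.initialLaw⟩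
  refine ⟨?_, fun μ hμ _ => ⟨?_, ?_⟩⟩
  · obtain ⟨μ, hμ⟩ := HMP.exists_isAttractive_hmpIFS hP hT hprim hpos
    exact ⟨μ, hμ, hF.isInvariant_of_isAttractive hμ⟩
  · have hc : Continuous fun x : stdSimplex ℝ 𝓢 => HMP.h (HMP.zeta T hT x) :=
      HMP.continuous_h.comp (HMP.continuous_vecMul.comp continuous_subtype_val)
    simp only [HMP.HasEntropyRate, hSZ.entropy_block_eq_sum hP hT hpos]
    exact HMP.tendsto_one_div_mul_sum_range_succ (hF.tendsto_dual_iterate hμ hc _)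
  · have hc : Continuous fun x : stdSimplex ℝ 𝓢 => HMP.h x :=
      HMP.continuous_h.comp continuous_subtype_val
    simp only [HMP.HasEstimationEntropy, hSZ.condEntropy_eq hP hT hpos]
    exact hF.tendsto_dual_iterate hμ hc _
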